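/- For $m\in\mathbb{N}=\{0,1,2,\dots\}$ let $P_m$ be the $(m+1)$-dimensional complex vector space of homogeneous polynomials of degree $m$ in two variables $x_1,x_2$, with the inner product determined by $\langle x_1^{l}x_2^{m-l},\,x_1^{k}x_2^{m-k}\rangle=l!\,(m-l)!\,\delta_{lk}$ for $0\le l,k\le m$, and let $\rho_m$ be the representation of $SU(2)$ on $P_m$ given by $(\rho_m(g)f)(x_1,x_2)=f((x_1,x_2)g)$, where $(x_1,x_2)g$ is the product of a row vector with a matrix. For a finite-dimensional complex Hilbert space $H$, let $\mathrm{End}(H)$ be the algebra of linear maps $H\to H$. Given representations $\pi_H,\pi_K$ of a group $G$ on finite-dimensional Hilbert spaces $H,K$, a linear map $\Phi:\mathrm{End}(H)\to\mathrm{End}(K)$ is called $G$-equivariant if $\Phi(\pi_H(g)A\pi_H(g)^{-1})=\pi_K(g)\Phi(A)\pi_K(g)^{-1}$ for all $g\in G$ and $A\in\mathrm{End}(H)$; it is a quantum channel if it is completely positive and trace preserving; and it is a $G$-irreducibly covariant channel if it is a $G$-equivariant quantum channel and both $\pi_H$ and $\pi_K$ are irreducible. Corollary 4.2. Let $r,m\in\mathbb{N}$,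 and let $\Phi:\mathrm{End}(P_r)\to\mathrm{End}(P_m)$ be a completely positive linear map that is $SU(2)$-equivariant with respect to $\rho_r$ and $\rho_m$. Then there are a real number $c\ge 0$ and an $SU(2)$-irreducibly covariant channel $\Psi:\mathrm{End}(P_r)\to\mathrm{End}(P_m)$ (with respect to $\rho_r$ and $\rho_m$) such that $\Phi=c\,\Psi$. -/

import Mathlib

namespace SU2Covariant

open MvPolynomial CStarAlgebra
open scoped Nat ComplexOrder ComplexConjugate

/-! ### The spaces of binary forms -/

/-- `BinaryForm m` is `P_m`, the space of homogeneous polynomials of degree `m` in two variables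
`x₁ = X 0`, `x₂ = X 1`, with complex coefficients. -/
def BinaryForm (m : ℕ) : Type :=
  homogeneousSubmodule (Fin 2) ℂ m

namespace BinaryForm

noncomputable instance (m : ℕ) : AddCommGroup (BinaryForm m) :=
  inferInstanceAs (AddCommGroup (homogeneousSubmodule (Fin 2) ℂ m))

noncomputable instance (m : ℕ) : Module ℂ (BinaryForm m) :=
  inferInstanceAs (Module ℂ (homogeneousSubmodule (Fin 2) ℂ m))

/-- The inclusion of `P_m` into the polynomial ring `ℂ[x₁, x₂]`. -/
noncomputable def toPoly (m : ℕ) : BinaryForm m →ₗ[ℂ] MvPolynomial (Fin 2) ℂ :=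
  (homogeneousSubmodule (Fin 2) ℂ m).subtype

theorem toPoly_injective (m : ℕ) : Function.Injective (toPoly m) :=
  (homogeneousSubmodule (Fin 2) ℂ m).injective_subtype

theorem toPoly_isHomogeneous {m : ℕ} (f : BinaryForm m) : (toPoly m f).IsHomogeneous m :=
  f.2

/-- A homogeneous polynomial of degree `m`, as an element of `P_m`. -/
def ofPoly {m : ℕ} (p : MvPolynomial (Fin 2) ℂ) (hp : p.IsHomogeneous m) : BinaryForm m :=
  ⟨p, hp⟩

@[simp]
theorem toPoly_ofPoly {m : ℕ} (p : MvPolynomial (Fin 2) ℂ) (hp : p.IsHomogeneous m) :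
    toPoly m (ofPoly p hp) = p :=
  rfl

instance (m : ℕ) : FiniteDimensional ℂ (BinaryForm m) :=
  Module.Finite.iff_fg.mpr (homogeneousSubmodule_fg (Fin 2) ℂ m)

/-- The exponent of the monomial `x₁ ^ l * x₂ ^ (m - l)`. -/
noncomputable def expo (m l : ℕ) : Fin 2 →₀ ℕ :=
  Finsupp.single 0 l + Finsupp.single 1 (m - l)

/-- The coefficient of `x₁ ^ l * x₂ ^ (m - l)` in `f`. -/
noncomputable def coef {m : ℕ} (l : ℕ) (f : BinaryForm m) : ℂ :=
  MvPolynomial.coeff (expo m l) (toPoly m f)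

theorem eq_zero_of_coef {m : ℕ} {f : BinaryForm m}
    (h : ∀ l ∈ Finset.range (m + 1), coef l f = 0) : f = 0 := by
  apply toPoly_injective m
  rw [map_zero]
  ext d
  by_contra hd
  have hdeg : d.degree = m := by
    have := toPoly_isHomogeneous f hd
    rw [show (1 : Fin 2 → ℕ) = fun _ => 1 from rfl, ← Finsupp.degree_eq_weight_one] at this
    exact this
  have hsum : d 0 + d 1 = m := by
    rw [← hdeg, Finsupp.degree_eq_sum, Fin.sum_univ_two]
  have hd' : expo m (d 0) = d := by
    ext i
    fin_cases i
    · simp [expo]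
    · simp [expo]; omega
  have h0 := h (d 0) (Finset.mem_range.mpr (by omega))
  rw [coef, hd'] at h0
  exact hd (by simpa using h0)

/-- The inner product on `P_m`, conjugate-linear in the first argument, for which
`⟪x₁ ^ l * x₂ ^ (m - l), x₁ ^ k * x₂ ^ (m - k)⟫ = l! (m - l)! δ_{lk}`. -/
@[reducible] noncomputable def core (m : ℕ) : InnerProductSpace.Core ℂ (BinaryForm m) where
  inner f g := ∑ l ∈ Finset.range (m + 1), ((l ! * (m - l)! : ℕ) : ℂ) * (conj (coef l f) * coef l g)
  conj_inner_symm f g := by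
    simp only [map_sum, map_mul, Complex.conj_conj, Complex.conj_natCast]
    exact Finset.sum_congr rfl fun l _ => by ring
  re_inner_nonneg f := by
    rw [map_sum]
    refine Finset.sum_nonneg fun l _ => ?_
    rw [← Complex.normSq_eq_conj_mul_self, ← Complex.ofReal_natCast, ← Complex.ofReal_mul]
    exact mul_nonneg (Nat.cast_nonneg _) (Complex.normSq_nonneg _)
  add_left f g k := by
    simp only [coef, map_add, MvPolynomial.coeff_add, ← Finset.sum_add_distrib]
    exact Finset.sum_congr rfl fun l _ => by ring
  smul_left f g c := by
    simp only [coef, map_smul, MvPolynomial.coeff_smul, smul_eq_mul, map_mul, Finset.mul_sum]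
    exact Finset.sum_congr rfl fun l _ => by ring
  definite f hf := by
    apply eq_zero_of_coef
    have key : (∑ l ∈ Finset.range (m + 1),
        ((l ! * (m - l)! : ℕ) : ℝ) * Complex.normSq (coef l f)) = 0 := by
      have h : ((∑ l ∈ Finset.range (m + 1),
        ((l ! * (m - l)! : ℕ) : ℝ) * Complex.normSq (coef l f) : ℝ) : ℂ) = 0 := by
        rw [← hf]
        push_cast
        exact Finset.sum_congr rfl fun l _ => by rw [Complex.normSq_eq_conj_mul_self]
      exact_mod_cast h
    intro l hl
    have := (Finset.sum_eq_zero_iff_of_nonneg fun l _ =>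
      mul_nonneg (Nat.cast_nonneg _) (Complex.normSq_nonneg _)).mp key l hl
    rcases mul_eq_zero.mp this with h | h
    · exact absurd h (by positivity)
    · exact Complex.normSq_eq_zero.mp h

noncomputable instance (m : ℕ) : NormedAddCommGroup (BinaryForm m) :=
  (core m).toNormedAddCommGroup

noncomputable instance (m : ℕ) : InnerProductSpace ℂ (BinaryForm m) :=
  InnerProductSpace.ofCore (core m).toCore

instance (m : ℕ) : CompleteSpace (BinaryForm m) :=
  FiniteDimensional.complete ℂ (BinaryForm m)

end BinaryForm

/-! ### The representations of `SU(2)` -/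

/-- The group `SU(2)`. -/
abbrev SU2 : Type := Matrix.specialUnitaryGroup (Fin 2) ℂ

/-- The substitution `f(x₁, x₂) ↦ f((x₁, x₂) g)` in the polynomial ring, where `(x₁, x₂) g` is
the product of a row vector with a matrix. -/
noncomputable def subst (g : Matrix (Fin 2) (Fin 2) ℂ) :
    MvPolynomial (Fin 2) ℂ →ₐ[ℂ] MvPolynomial (Fin 2) ℂ :=
  aeval fun j => ∑ i, X i * C (g i j)

theorem subst_isHomogeneous (g : Matrix (Fin 2) (Fin 2) ℂ) {m : ℕ}
    {f : MvPolynomial (Fin 2) ℂ} (hf : f.IsHomogeneous m) : (subst g f).IsHomogeneous m := by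
  have h : ∀ j : Fin 2, (∑ i, X i * C (g i j) : MvPolynomial (Fin 2) ℂ).IsHomogeneous 1 :=
    fun j => IsHomogeneous.sum _ _ _ fun i _ =>
      (isHomogeneous_X ℂ i).mul (isHomogeneous_C (Fin 2) (g i j))
  have h2 := hf.aeval _ h
  rw [one_mul] at h2
  exact h2

theorem subst_one (f : MvPolynomial (Fin 2) ℂ) : subst 1 f = f := by
  have : subst 1 = AlgHom.id ℂ (MvPolynomial (Fin 2) ℂ) := by
    ext1 j
    simp [subst, Matrix.one_apply]
  rw [this, AlgHom.id_apply]

theorem subst_mul (g h : Matrix (Fin 2) (Fin 2) ℂ) (f : MvPolynomial (Fin 2) ℂ) :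
    subst (g * h) f = subst g (subst h f) := by
  have : subst (g * h) = (subst g).comp (subst h) := by
    ext1 j
    simp [subst, Matrix.mul_apply, Fin.sum_univ_two, algebraMap_eq]
    ring
  rw [this, AlgHom.comp_apply]

/-- The representation `ρ_m` of `SU(2)` on `P_m`, `(ρ_m(g) f)(x₁, x₂) = f((x₁, x₂) g)`. -/
noncomputable def rho (m : ℕ) : Representation ℂ SU2 (BinaryForm m) where
  toFun g :=
    { toFun := fun f => BinaryForm.ofPoly (subst g.1 (BinaryForm.toPoly m f))
        (subst_isHomogeneous g.1 (BinaryForm.toPoly_isHomogeneous f))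
      map_add' := fun f f' => BinaryForm.toPoly_injective m (by simp)
      map_smul' := fun c f => BinaryForm.toPoly_injective m (by simp) }
  map_one' := LinearMap.ext fun f =>
    BinaryForm.toPoly_injective m (subst_one (BinaryForm.toPoly m f))
  map_mul' g h := LinearMap.ext fun f =>
    BinaryForm.toPoly_injective m (subst_mul g.1 h.1 (BinaryForm.toPoly m f))

/-! ### Quantum channels and covariance -/

section Channels

variable {H K : Type*} [NormedAddCommGroup H] [InnerProductSpace ℂ H] [FiniteDimensional ℂ H]
  [CompleteSpace H] [NormedAddCommGroup K] [InnerProductSpace ℂ K] [FiniteDimensional ℂ K]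
  [CompleteSpace K]

/-- A linear map `Φ : End(H) → End(K)`, for finite-dimensional Hilbert spaces `H` and `K`, is
completely positive if it is so as a map between the C⋆-algebras of (automatically continuous)
linear operators on `H` and on `K`: for every `k`, applying `Φ` to the entries of a positive
`k × k` matrix over `End(H)` gives a positive matrix over `End(K)`. -/
def IsCompletelyPositive (Φ : (H →ₗ[ℂ] H) →ₗ[ℂ] (K →ₗ[ℂ] K)) : Prop :=
  ∃ Ψ : (H →L[ℂ] H) →CP (K →L[ℂ] K), ∀ A : H →ₗ[ℂ] H,
    Ψ (LinearMap.toContinuousLinearMap A) = LinearMap.toContinuousLinearMap (Φ A)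

/-- A quantum channel is a completely positive trace-preserving linear map `End(H) → End(K)`. -/
structure IsQuantumChannel (Φ : (H →ₗ[ℂ] H) →ₗ[ℂ] (K →ₗ[ℂ] K)) : Prop where
  completelyPositive : IsCompletelyPositive Φ
  trace_preserving : ∀ A : H →ₗ[ℂ] H, LinearMap.trace ℂ K (Φ A) = LinearMap.trace ℂ H A

end Channels

/-- `Φ : End(H) → End(K)` is `G`-equivariant for the representations
`A ↦ π(g) A π(g⁻¹)` of `G` on `End(H)` and `End(K)`. -/
def IsEquivariant {G H K : Type*} [Group G] [AddCommGroup H] [Module ℂ H] [AddCommGroup K]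
    [Module ℂ K] (π : Representation ℂ G H) (σ : Representation ℂ G K)
    (Φ : (H →ₗ[ℂ] H) →ₗ[ℂ] (K →ₗ[ℂ] K)) : Prop :=
  (π.linHom π).IsIntertwiningMap (σ.linHom σ) Φ

/-- A `G`-irreducibly covariant channel with respect to representations `π` on `H` and `σ` on `K`:
a quantum channel that is `G`-equivariant, where both `π` and `σ` are irreducible. -/
structure IsIrreduciblyCovariantChannel {G H K : Type*} [Group G]
    [NormedAddCommGroup H] [InnerProductSpace ℂ H] [FiniteDimensional ℂ H] [CompleteSpace H]
    [NormedAddCommGroup K] [InnerProductSpace ℂ K] [FiniteDimensional ℂ K] [CompleteSpace K]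
    (π : Representation ℂ G H) (σ : Representation ℂ G K)
    (Φ : (H →ₗ[ℂ] H) →ₗ[ℂ] (K →ₗ[ℂ] K)) : Prop where
  channel : IsQuantumChannel Φ
  equivariant : IsEquivariant π σ Φ
  irreducible_source : π.IsIrreducible
  irreducible_target : σ.IsIrreducible

end SU2Covariant

/-! Equivariance makes `A ↦ tr (Φ A)` a conjugation-invariant functional on the endomorphisms of an
irreducible representation. By Schur's lemma it equals `c * tr A` (`exists_eq_mul_trace`), and
positivity at `A = 1` gives `c ≥ 0`. If `c > 0`, then `c⁻¹ • Φ` preserves the trace and is the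
required channel. If `c = 0`, every positive operator has a positive image of trace zero, so `Φ = 0`
(`IsCompletelyPositive.eq_zero`); any covariant channel then serves, and the completely depolarizing
one is used.

Irreducibility (`rho_isIrreducible`) comes from weights: a diagonal element with distinct
eigenvalues isolates monomials, and one element without zero entries connects them through `x₁ ^ m`.
-/

namespace SU2Covariant

open MvPolynomial CStarAlgebra
open scoped Nat ComplexOrder ComplexConjugate

/-! ### Schur's lemma and invariant functionals -/

section Schur

variable {G V : Type*} [Group G] [AddCommGroup V] [Module ℂ V] [FiniteDimensional ℂ V]

/-- Schur's lemma for endomorphisms, in terms of linear maps. -/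
theorem exists_eq_smul_id_of_commute (π : Representation ℂ G V) (hπ : π.IsIrreducible)
    (X : V →ₗ[ℂ] V) (hX : ∀ g v, X (π g v) = π g (X v)) : ∃ c : ℂ, ∀ v, X v = c • v := by
  let f : π.IntertwiningMap π := X.intertwiningMap_of_isIntertwiningMap π π hX
  obtain ⟨c, hc⟩ :=
    (Representation.IsIrreducible.algebraMap_intertwiningMap_bijective_of_isAlgClosed
      (k := ℂ) (ρ := π)).2 f
  refine ⟨c, fun v => ?_⟩
  have := congrArg (fun F : π.IntertwiningMap π => F v) hc
  rw [Algebra.algebraMap_eq_smul_one] at this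
  exact this.symm

/-- A conjugation-invariant linear functional on the endomorphisms of an irreducible representation
is a multiple of the trace. -/
theorem exists_eq_mul_trace (π : Representation ℂ G V) (hπ : π.IsIrreducible)
    (F : (V →ₗ[ℂ] V) →ₗ[ℂ] ℂ) (hF : ∀ g A, F (π.linHom π g A) = F A) :
    ∃ c : ℂ, ∀ A, F A = c * LinearMap.trace ℂ V A := by
  -- For fixed `v`, the map `f ↦ F (f.smulRight v)` lies in the double dual. Reflexivity turns it
  -- into a vector `X v`, and invariance of `F` makes `X` commute with the group.
  let B : V →ₗ[ℂ] Module.Dual ℂ (Module.Dual ℂ V) :=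
    (LinearMap.smulRightₗ.compr₂ F).flip
  let X : V →ₗ[ℂ] V := (Module.evalEquiv ℂ V).symm.toLinearMap ∘ₗ B
  have hX : ∀ (f : Module.Dual ℂ V) v, f (X v) = F (f.smulRight v) := by
    intro f v
    simp [X, B]
  obtain ⟨c, hc⟩ := exists_eq_smul_id_of_commute π hπ X (by
    intro g v
    refine sub_eq_zero.1 ((Module.forall_dual_apply_eq_zero_iff ℂ _).1 ?_)
    intro f
    have h2 : f (π g (X v)) = F ((f ∘ₗ π g).smulRight v) := hX (f ∘ₗ π g) v
    rw [map_sub, sub_eq_zero, hX, h2, ← hF g ((f ∘ₗ π g).smulRight v)]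
    congr 1
    ext w
    simp [Representation.linHom_apply])
  refine ⟨c, fun A => ?_⟩
  -- Rank-one operators span, and on them `X = c • id` reads `F = c * trace`.
  obtain ⟨t, rfl⟩ := (dualTensorHomEquiv ℂ V V).surjective A
  induction t with
  | zero => simp
  | add x y hx hy => rw [map_add, map_add, hx, hy, map_add, mul_add]
  | tmul f v =>
    have h1 : dualTensorHomEquiv ℂ V V (f ⊗ₜ[ℂ] v) = f.smulRight v := by
      ext w; simp
    rw [h1, ← hX, hc, LinearMap.trace_smulRight, map_smul, smul_eq_mul]

end Schur

/-- The trace of `S⋆ S` is the sum of the squared norms of the images of an orthonormal basis. -/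
theorem trace_star_mul_self {K ι : Type*} [NormedAddCommGroup K] [InnerProductSpace ℂ K]
    [CompleteSpace K] [Fintype ι] (b : OrthonormalBasis ι ℂ K) (S : K →L[ℂ] K) :
    LinearMap.trace ℂ K ((star S * S : K →L[ℂ] K) : K →ₗ[ℂ] K) =
      ((∑ i, ‖S (b i)‖ ^ 2 : ℝ) : ℂ) := by
  rw [LinearMap.trace_eq_sum_inner _ b]
  push_cast
  refine Finset.sum_congr rfl fun i _ => ?_
  rw [ContinuousLinearMap.star_eq_adjoint]
  simp [ContinuousLinearMap.adjoint_inner_right, inner_self_eq_norm_sq_to_K]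

/-! ### Completely positive maps and their traces -/

section Channels

variable {H K : Type*} [NormedAddCommGroup H] [InnerProductSpace ℂ H] [FiniteDimensional ℂ H]
  [CompleteSpace H] [NormedAddCommGroup K] [InnerProductSpace ℂ K] [FiniteDimensional ℂ K]
  [CompleteSpace K]

theorem IsCompletelyPositive.nonneg {Φ : (H →ₗ[ℂ] H) →ₗ[ℂ] (K →ₗ[ℂ] K)}
    (hΦ : IsCompletelyPositive Φ) {A : H →L[ℂ] H} (hA : 0 ≤ A) :
    0 ≤ LinearMap.toContinuousLinearMap (Φ (A : H →ₗ[ℂ] H)) := by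
  obtain ⟨Ψ, hΨ⟩ := hΦ
  rw [← hΨ]
  have h : LinearMap.toContinuousLinearMap (A : H →ₗ[ℂ] H) = A := by ext; rfl
  rw [h]
  exact map_nonneg Ψ hA

theorem IsCompletelyPositive.smul {Φ : (H →ₗ[ℂ] H) →ₗ[ℂ] (K →ₗ[ℂ] K)}
    (hΦ : IsCompletelyPositive Φ) {c : ℝ} (hc : 0 ≤ c) : IsCompletelyPositive ((c : ℂ) • Φ) := by
  obtain ⟨Ψ, hΨ⟩ := hΦ
  refine ⟨{ toLinearMap := (c : ℂ) • Ψ.toLinearMap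
            map_cstarMatrix_nonneg' := fun k M hM => ?_ }, fun A => ?_⟩
  · have h := StarOrderedRing.nonneg_iff.1 (Ψ.map_cstarMatrix_nonneg' k M hM)
    have h2 : M.map ((c : ℂ) • Ψ.toLinearMap) = (c : ℂ) • M.map Ψ.toLinearMap := rfl
    rw [h2]
    -- Nonnegative elements are sums of terms `star N * N`, and `√c` is absorbed into each `N`.
    generalize M.map Ψ.toLinearMap = P at h
    induction h using AddSubmonoid.closure_induction with
    | zero => rw [smul_zero]
    | add x y _ _ hx hy => rw [smul_add]; exact add_nonneg hx hy
    | mem x hx =>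
      obtain ⟨N, rfl⟩ := hx
      have : (c : ℂ) • (star N * N) = star (((√c : ℝ) : ℂ) • N) * (((√c : ℝ) : ℂ) • N) := by
        rw [star_smul, smul_mul_smul_comm, RCLike.star_def, Complex.conj_ofReal,
          ← Complex.ofReal_mul, Real.mul_self_sqrt hc]
      rw [this]
      exact star_mul_self_nonneg _
  · rw [LinearMap.smul_apply, map_smul, ← hΨ]
    rfl

theorem trace_nonneg_of_nonneg {T : K →L[ℂ] K} (hT : 0 ≤ T) :
    0 ≤ LinearMap.trace ℂ K (T : K →ₗ[ℂ] K) := by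
  obtain ⟨S, rfl⟩ := CStarAlgebra.nonneg_iff_eq_star_mul_self.1 hT
  rw [trace_star_mul_self (stdOrthonormalBasis ℂ K)]
  exact_mod_cast Finset.sum_nonneg fun i _ => by positivity

/-- Writing `T = S⋆ S`, the trace is a sum of squared norms, so `S` kills an orthonormal basis. -/
theorem eq_zero_of_nonneg_of_trace_eq_zero {T : K →L[ℂ] K} (hT : 0 ≤ T)
    (h : LinearMap.trace ℂ K (T : K →ₗ[ℂ] K) = 0) : T = 0 := by
  obtain ⟨S, rfl⟩ := CStarAlgebra.nonneg_iff_eq_star_mul_self.1 hT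
  rw [trace_star_mul_self (stdOrthonormalBasis ℂ K), Complex.ofReal_eq_zero,
    Finset.sum_eq_zero_iff_of_nonneg fun i _ => by positivity] at h
  have hS : S = 0 := by
    apply ContinuousLinearMap.coe_injective
    apply (stdOrthonormalBasis ℂ K).toBasis.ext
    intro i
    simpa using h i (Finset.mem_univ i)
  rw [hS, mul_zero]

/-- A completely positive map whose outputs all have trace zero vanishes. -/
theorem IsCompletelyPositive.eq_zero {Φ : (H →ₗ[ℂ] H) →ₗ[ℂ] (K →ₗ[ℂ] K)}
    (hΦ : IsCompletelyPositive Φ) (h : ∀ A, LinearMap.trace ℂ K (Φ A) = 0) : Φ = 0 := by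
  let F : (H →L[ℂ] H) →ₗ[ℂ] (K →ₗ[ℂ] K) :=
    Φ ∘ₗ (LinearMap.toContinuousLinearMap (𝕜 := ℂ) (E := H) (F' := H)).symm.toLinearMap
  have hF : F = 0 := by
    apply LinearMap.ext_on (s := {a : H →L[ℂ] H | 0 ≤ a}) CStarAlgebra.span_nonneg
    intro A hA
    have := eq_zero_of_nonneg_of_trace_eq_zero (hΦ.nonneg hA) (h _)
    exact (LinearMap.toContinuousLinearMap (𝕜 := ℂ) (E := K) (F' := K)).map_eq_zero_iff.1 this
  ext1 A
  exact LinearMap.congr_fun hF (LinearMap.toContinuousLinearMap A)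

/-- The map `A ↦ tr(A) 1`. -/
noncomputable def traceOne (H K : Type*) [NormedAddCommGroup H] [InnerProductSpace ℂ H]
    [NormedAddCommGroup K] [InnerProductSpace ℂ K] : (H →ₗ[ℂ] H) →ₗ[ℂ] (K →ₗ[ℂ] K) :=
  (LinearMap.trace ℂ H).smulRight LinearMap.id

/-- Expand the trace of each entry of `star N * N` in an orthonormal basis `b` and insert a
resolution of the identity between the two factors. The image becomes a sum of `star W * W`, where
`W` has scalar entries, the matrix coefficients of `N` in `b`. -/
theorem isCompletelyPositive_traceOne : IsCompletelyPositive (traceOne H K) := by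
  let T : (H →L[ℂ] H) →ₗ[ℂ] (K →L[ℂ] K) :=
    (LinearMap.toContinuousLinearMap (𝕜 := ℂ) (E := K) (F' := K)).toLinearMap ∘ₗ traceOne H K ∘ₗ
      (LinearMap.toContinuousLinearMap (𝕜 := ℂ) (E := H) (F' := H)).symm.toLinearMap
  refine ⟨{ toLinearMap := T, map_cstarMatrix_nonneg' := fun k M hM => ?_ }, fun A => rfl⟩
  have h := StarOrderedRing.nonneg_iff.1 hM
  induction h using AddSubmonoid.closure_induction with
  | zero =>
    have : (0 : CStarMatrix (Fin k) (Fin k) (H →L[ℂ] H)).map T = 0 := by ext1 p q; exact map_zero T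
    exact this.ge
  | add x y hx' hy' hx hy =>
    have : (x + y).map T = x.map T + y.map T := by ext1 p q; exact map_add T _ _
    rw [this]
    exact add_nonneg (hx (StarOrderedRing.nonneg_iff.2 hx'))
      (hy (StarOrderedRing.nonneg_iff.2 hy'))
  | mem x hx =>
    obtain ⟨N, rfl⟩ := hx
    let b := stdOrthonormalBasis ℂ H
    let W (i j : Fin (Module.finrank ℂ H)) : CStarMatrix (Fin k) (Fin k) (K →L[ℂ] K) :=
      CStarMatrix.ofMatrix fun d a => (inner ℂ (b j) (N d a (b i))) • (1 : K →L[ℂ] K)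
    have key : (star N * N).map T = ∑ i, ∑ j, star (W i j) * W i j := by
      ext1 p q
      have h1 : (∑ i, ∑ j, star (W i j) * W i j) p q
          = ∑ i, ∑ j, (star (W i j) * W i j) p q := by
        let E : CStarMatrix (Fin k) (Fin k) (K →L[ℂ] K) →+ (K →L[ℂ] K) :=
          { toFun := fun P => P p q, map_zero' := rfl, map_add' := fun _ _ => rfl }
        exact (map_sum E (fun i => ∑ j, star (W i j) * W i j) Finset.univ).trans
          (Finset.sum_congr rfl fun i _ => map_sum E (fun j => star (W i j) * W i j) Finset.univ)
      have h2 : (star N * N).map T p q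
          = LinearMap.trace ℂ H (((star N * N) p q : H →L[ℂ] H) : H →ₗ[ℂ] H) •
            (1 : K →L[ℂ] K) := rfl
      have h3 (i j) : (star (W i j) * W i j) p q = (∑ d, conj (inner ℂ (b j) (N d p (b i))) *
          inner ℂ (b j) (N d q (b i))) • (1 : K →L[ℂ] K) := by
        rw [CStarMatrix.mul_apply, Finset.sum_smul]
        refine Finset.sum_congr rfl fun d _ => ?_
        rw [CStarMatrix.star_apply]
        change star ((inner ℂ (b j) (N d p (b i))) • (1 : K →L[ℂ] K)) *
          ((inner ℂ (b j) (N d q (b i))) • (1 : K →L[ℂ] K)) = _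
        rw [star_smul, star_one, smul_mul_smul_comm, one_mul]
        rfl
      rw [h1, h2]
      simp_rw [h3, ← Finset.sum_smul]
      congr 1
      rw [LinearMap.trace_eq_sum_inner _ b]
      refine Finset.sum_congr rfl fun i _ => ?_
      rw [Finset.sum_comm, CStarMatrix.mul_apply]
      rw [ContinuousLinearMap.coe_coe, sum_apply, inner_sum]
      refine Finset.sum_congr rfl fun d _ => ?_
      rw [CStarMatrix.star_apply, ContinuousLinearMap.star_eq_adjoint,
        mul_apply_eq_comp, ContinuousLinearMap.adjoint_inner_right,
        ← b.sum_inner_mul_inner]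
      refine Finset.sum_congr rfl fun j _ => ?_
      rw [inner_conj_symm]
    rw [key]
    exact Finset.sum_nonneg fun i _ => Finset.sum_nonneg fun j _ => star_mul_self_nonneg _

end Channels

/-! ### Monomial coordinates on binary forms -/

namespace BinaryForm

variable {m : ℕ}

theorem coef_add (l : ℕ) (f g : BinaryForm m) : coef l (f + g) = coef l f + coef l g := by
  simp [coef]

theorem coef_smul (l : ℕ) (c : ℂ) (f : BinaryForm m) : coef l (c • f) = c * coef l f := by
  simp [coef]

theorem ext_coef {f g : BinaryForm m} (h : ∀ l ≤ m, coef l f = coef l g) : f = g := by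
  rw [← sub_eq_zero]
  refine eq_zero_of_coef fun l hl => ?_
  have := h l (by simpa [Nat.lt_succ_iff] using hl)
  simpa [coef, sub_eq_zero] using this

theorem monomial_isHomogeneous {l : ℕ} (hl : l ≤ m) :
    (X 0 ^ l * X 1 ^ (m - l) : MvPolynomial (Fin 2) ℂ).IsHomogeneous m := by
  have := (isHomogeneous_X_pow (R := ℂ) (0 : Fin 2) l).mul
    (isHomogeneous_X_pow (R := ℂ) (1 : Fin 2) (m - l))
  rwa [Nat.add_sub_cancel' hl] at this

/-- The monomial `x₁ ^ l * x₂ ^ (m - l)`, for `l ≤ m`. -/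
noncomputable def mono (l : Fin (m + 1)) : BinaryForm m :=
  ofPoly (X 0 ^ (l : ℕ) * X 1 ^ (m - l)) (monomial_isHomogeneous l.is_le)

theorem X_pow_mul_X_pow (a b : ℕ) : (X 0 ^ a * X 1 ^ b : MvPolynomial (Fin 2) ℂ) =
    monomial (Finsupp.single 0 a + Finsupp.single 1 b) 1 := by
  rw [X_pow_eq_monomial, X_pow_eq_monomial, monomial_mul, one_mul]

theorem coef_mono (l : Fin (m + 1)) (k : ℕ) :
    coef k (mono l) = if (l : ℕ) = k then 1 else 0 := by
  rw [coef, mono, toPoly_ofPoly, X_pow_mul_X_pow, coeff_monomial]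
  congr 1
  rw [eq_iff_iff]
  constructor
  · intro h
    simpa [expo] using DFunLike.congr_fun h 0
  · rintro rfl
    rfl

theorem coef_sum {ι : Type*} (s : Finset ι) (l : ℕ) (f : ι → BinaryForm m) :
    coef l (∑ i ∈ s, f i) = ∑ i ∈ s, coef l (f i) := by
  simp [coef, coeff_sum]

theorem coef_sum_smul_mono (a : Fin (m + 1) → ℂ) (l : Fin (m + 1)) :
    coef l (∑ k, a k • mono k) = a l := by
  simp [coef_sum, coef_smul, coef_mono, ← Fin.ext_iff]

theorem eq_sum_mono (f : BinaryForm m) : f = ∑ l : Fin (m + 1), coef l f • mono l :=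
  ext_coef fun k hk =>
    (coef_sum_smul_mono (fun l => coef l f) ⟨k, Nat.lt_succ_of_le hk⟩).symm

end BinaryForm

open BinaryForm

/-! ### Irreducibility -/

theorem toPoly_rho (m : ℕ) (g : SU2) (f : BinaryForm m) :
    toPoly m (rho m g f) = subst g.1 (toPoly m f) := rfl

/-- The element of `SU(2)` with first row `(a, -conj b)` and second row `(b, conj a)`. -/
noncomputable def su2Mk (a b : ℂ) (h : a * conj a + b * conj b = 1) : SU2 :=
  ⟨!![a, -conj b; b, conj a], by
    rw [Matrix.mem_specialUnitaryGroup_iff]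
    constructor
    · rw [Matrix.mem_unitaryGroup_iff']
      ext i j
      fin_cases i <;> fin_cases j <;>
        simp [Matrix.mul_apply, Matrix.star_apply, Fin.sum_univ_two] <;>
        first | linear_combination h | ring
    · rw [Matrix.det_fin_two_of]
      linear_combination h⟩

theorem rho_diag_mono {m : ℕ} (u : ℂ) (h : u * conj u + 0 * conj 0 = 1) (l : Fin (m + 1)) :
    rho m (su2Mk u 0 h) (mono l) = (u ^ (l : ℕ) * conj u ^ (m - l : ℕ)) • mono l := by
  apply toPoly_injective m
  rw [toPoly_rho, map_smul, mono, toPoly_ofPoly]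
  simp only [su2Mk, subst, map_mul, map_pow, aeval_X, Fin.sum_univ_two]
  simp [smul_eq_C_mul, mul_pow]
  ring

theorem coef_rho_diag {m : ℕ} (u : ℂ) (h : u * conj u + 0 * conj 0 = 1) (f : BinaryForm m)
    (l : Fin (m + 1)) :
    coef l (rho m (su2Mk u 0 h) f) = (u ^ (l : ℕ) * conj u ^ (m - l : ℕ)) * coef l f := by
  conv_lhs => rw [eq_sum_mono f, map_sum]
  simp_rw [map_smul, rho_diag_mono, smul_smul]
  rw [coef_sum_smul_mono, mul_comm]

theorem coef_aeval {m : ℕ} {T : BinaryForm m →ₗ[ℂ] BinaryForm m} {l : ℕ} {c : ℂ}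
    (hT : ∀ f, coef l (T f) = c * coef l f) (q : Polynomial ℂ) (f : BinaryForm m) :
    coef l (Polynomial.aeval T q f) = q.eval c * coef l f := by
  induction q using Polynomial.induction_on' generalizing f with
  | add p q hp hq =>
    rw [map_add, LinearMap.add_apply, coef_add, hp, hq, Polynomial.eval_add, add_mul]
  | monomial n a =>
    rw [Polynomial.aeval_monomial, Module.algebraMap_end_eq_smul_id, Polynomial.eval_monomial]
    change coef l (a • (T ^ n) f) = _
    rw [coef_smul, mul_assoc]
    congr 1
    induction n generalizing f with
    | zero => simp
    | succ n ih => rw [pow_succ, Module.End.mul_apply, ih, hT]; ring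

/-- A submodule stable under an operator acting on coefficients with distinct eigenvalues contains
every monomial that occurs in one of its elements. -/
theorem mono_mem_of_coef_ne_zero {m : ℕ} {W : Submodule ℂ (BinaryForm m)}
    {T : BinaryForm m →ₗ[ℂ] BinaryForm m} (hW : ∀ f ∈ W, T f ∈ W) {c : Fin (m + 1) → ℂ}
    (hc : Function.Injective c) (hT : ∀ (l : Fin (m + 1)) f, coef l (T f) = c l * coef l f)
    {f : BinaryForm m} (hf : f ∈ W) {l : Fin (m + 1)} (hl : coef l f ≠ 0) : mono l ∈ W := by
  -- The Lagrange polynomial is 1 at `c l` and 0 at the other eigenvalues, so `q(T)` projects onto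
  -- the line of `mono l`.
  let q := Lagrange.basis Finset.univ c l
  have hmem : Polynomial.aeval T q f ∈ W :=
    Polynomial.aeval_apply_smul_mem_of_le_comap hf q T hW
  have heq : Polynomial.aeval T q f = coef l f • mono l := by
    refine ext_coef fun k hk => ?_
    have := coef_aeval (hT ⟨k, Nat.lt_succ_of_le hk⟩) q f
    rw [coef_smul, coef_mono]
    rw [this]
    split_ifs with h
    · subst h
      rw [Lagrange.eval_basis_self hc.injOn (Finset.mem_univ _)]
      simp
    · rw [Lagrange.eval_basis_of_ne (fun h' => h (congrArg Fin.val h')) (Finset.mem_univ _)]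
      simp
  rw [heq] at hmem
  exact (W.smul_mem_iff hl).1 hmem

/-- The coefficient of `x₁ ^ m` is the value at `(1, 0)`. -/
theorem coef_top {m : ℕ} (f : BinaryForm m) : coef m f = eval ![1, 0] (toPoly m f) := by
  conv_rhs => rw [eq_sum_mono f, map_sum, map_sum, Fin.sum_univ_castSucc]
  rw [Finset.sum_eq_zero, zero_add]
  · simp [mono, smul_eval]
  · intro l _
    have : m - (l : ℕ) ≠ 0 := by omega
    simp [mono, smul_eval, this]

/-- Nonzero as soon as `a` and `b` are, so every monomial leads to `x₁ ^ m`. -/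
theorem coef_top_rho_mono {m : ℕ} (a b : ℂ) (h : a * conj a + b * conj b = 1) (l : Fin (m + 1)) :
    coef m (rho m (su2Mk a b h) (mono l)) = a ^ (l : ℕ) * (-conj b) ^ (m - l : ℕ) := by
  rw [coef_top, toPoly_rho, mono, toPoly_ofPoly]
  simp [su2Mk, subst, Fin.sum_univ_two]

theorem rho_mono_last {m : ℕ} (a b : ℂ) (h : a * conj a + b * conj b = 1) :
    rho m (su2Mk a b h) (mono (Fin.last m)) =
      ∑ l : Fin (m + 1), (a ^ (l : ℕ) * b ^ (m - l : ℕ) * m.choose l) • mono l := by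
  apply toPoly_injective m
  rw [toPoly_rho, mono, toPoly_ofPoly, map_sum]
  simp only [su2Mk, subst, map_mul, map_pow, aeval_X, Fin.sum_univ_two, map_smul, mono,
    toPoly_ofPoly]
  rw [Fin.sum_univ_eq_sum_range (fun l => (a ^ l * b ^ (m - l) * m.choose l) •
    (X 0 ^ l * X 1 ^ (m - l) : MvPolynomial (Fin 2) ℂ))]
  simp only [Fin.val_last, Nat.sub_self, pow_zero, mul_one, add_pow]
  refine Finset.sum_congr rfl fun l _ => ?_
  simp [smul_eq_C_mul, mul_pow]
  ring

/-- The way back: for nonzero `a` and `b`, `x₁ ^ m` leads to every monomial. -/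
theorem coef_rho_mono_last {m : ℕ} (a b : ℂ) (h : a * conj a + b * conj b = 1)
    (l : Fin (m + 1)) :
    coef l (rho m (su2Mk a b h) (mono (Fin.last m))) =
      a ^ (l : ℕ) * b ^ (m - l : ℕ) * m.choose l := by
  rw [rho_mono_last, coef_sum_smul_mono]

theorem rho_isIrreducible (m : ℕ) : (rho m).IsIrreducible := by
  obtain ⟨u, hu, hinj⟩ : ∃ u : ℂ, u * conj u = 1 ∧
      Function.Injective fun l : Fin (m + 1) => u ^ (l : ℕ) * conj u ^ (m - l : ℕ) := by
    have hprim := Complex.isPrimitiveRoot_exp (m + 1) m.succ_ne_zero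
    -- The eigenvalues are `u ^ (2l - m)`; they are distinct for `0 ≤ l ≤ m` because `u ^ 2` is a
    -- primitive root of unity of order `m + 1`.
    set u : ℂ := Complex.exp ((Real.pi / (m + 1) : ℝ) * Complex.I)
    have hsq : u ^ 2 = Complex.exp (2 * Real.pi * Complex.I / ((m + 1 : ℕ) : ℂ)) := by
      rw [← Complex.exp_nat_mul]
      congr 1
      push_cast
      ring
    have hu : u * conj u = 1 := by
      rw [Complex.mul_conj, Complex.normSq_eq_norm_sq, Complex.norm_exp_ofReal_mul_I]
      simp
    rw [← hsq] at hprim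
    have key (l : Fin (m + 1)) : u ^ m * (u ^ (l : ℕ) * conj u ^ (m - l : ℕ)) = (u ^ 2) ^ (l : ℕ) := by
      have hm : u ^ m = u ^ (l : ℕ) * u ^ (m - l : ℕ) := by
        rw [← pow_add, Nat.add_sub_cancel' l.is_le]
      have := congrArg (· ^ (m - l : ℕ)) hu
      simp only [mul_pow, one_pow] at this
      rw [hm, ← pow_mul, mul_comm 2, pow_mul]
      linear_combination (u ^ (l : ℕ)) ^ 2 * this
    refine ⟨u, hu, fun l k hlk => Fin.ext (hprim.pow_inj l.2 k.2 ?_)⟩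
    rw [← key, ← key]
    exact congrArg _ hlk
  have hd : u * conj u + 0 * conj 0 = 1 := by rw [hu]; simp
  -- A Pythagorean triple gives an element of `SU(2)` with no zero entry.
  have hr : (3 / 5 : ℂ) * conj (3 / 5) + 4 / 5 * conj (4 / 5) = 1 := by
    simp only [map_div₀, map_ofNat]; norm_num
  have hne : ∃ f : BinaryForm m, f ≠ 0 := ⟨mono 0, fun h => by
    have := coef_mono (m := m) 0 0
    rw [h] at this
    simp [coef] at this⟩
  refine { exists_pair_ne := ⟨⊥, ⊤, fun h => ?_⟩, eq_bot_or_eq_top := fun W => ?_ }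
  · obtain ⟨f, hf⟩ := hne
    have : f ∈ (⊤ : Subrepresentation (rho m)) := Submodule.mem_top
    rw [← h] at this
    exact hf ((Submodule.mem_bot ℂ).1 this)
  · by_cases hW : ∃ f ∈ W.toSubmodule, f ≠ 0
    · right
      obtain ⟨f, hf, hf0⟩ := hW
      have hmem {f : BinaryForm m} (hf : f ∈ W.toSubmodule) (l : Fin (m + 1))
          (hl : coef l f ≠ 0) : mono l ∈ W.toSubmodule :=
        mono_mem_of_coef_ne_zero (fun f hf => W.apply_mem_toSubmodule (su2Mk u 0 hd) hf) hinj
          (fun l f => coef_rho_diag u hd f l) hf hl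
      obtain ⟨l, hl⟩ : ∃ l : Fin (m + 1), coef l f ≠ 0 := by
        by_contra! h
        exact hf0 (eq_zero_of_coef fun l hl => h ⟨l, Finset.mem_range.1 hl⟩)
      have hlast : mono (Fin.last m) ∈ W.toSubmodule := by
        refine hmem (W.apply_mem_toSubmodule (su2Mk _ _ hr) (hmem hf l hl)) _ ?_
        rw [Fin.val_last, coef_top_rho_mono]
        simp
      have hall (l : Fin (m + 1)) : mono l ∈ W.toSubmodule := by
        refine hmem (W.apply_mem_toSubmodule (su2Mk _ _ hr) hlast) _ ?_
        rw [coef_rho_mono_last]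
        have := (Nat.choose_pos l.is_le).ne'
        simp [this]
      apply Subrepresentation.toSubmodule_injective
      refine (eq_top_iff.2 fun f _ => ?_ : W.toSubmodule = ⊤)
      rw [eq_sum_mono f]
      exact Submodule.sum_mem _ fun l _ => Submodule.smul_mem _ _ (hall l)
    · left
      push Not at hW
      apply Subrepresentation.toSubmodule_injective
      exact (Submodule.eq_bot_iff _).2 hW

/-! ### Equivariance of the trace and the normalization of the map -/

theorem trace_linHom {G V : Type*} [Group G] [AddCommGroup V] [Module ℂ V]
    [FiniteDimensional ℂ V] (π : Representation ℂ G V) (g : G) (A : V →ₗ[ℂ] V) :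
    LinearMap.trace ℂ V (π.linHom π g A) = LinearMap.trace ℂ V A := by
  rw [Representation.linHom_apply, LinearMap.trace_comp_comm', LinearMap.comp_assoc,
    ← Module.End.mul_eq_comp (π g⁻¹), ← map_mul, inv_mul_cancel, map_one]
  rfl

theorem isEquivariant_traceOne {G H K : Type*} [Group G] [NormedAddCommGroup H]
    [InnerProductSpace ℂ H] [FiniteDimensional ℂ H] [NormedAddCommGroup K]
    [InnerProductSpace ℂ K] (π : Representation ℂ G H) (σ : Representation ℂ G K) :
    IsEquivariant π σ (traceOne H K) := by
  refine ⟨fun g A => ?_⟩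
  rw [traceOne, LinearMap.smulRight_apply, LinearMap.smulRight_apply, trace_linHom, map_smul]
  congr 1
  ext v
  simp [Representation.linHom_apply]

theorem exists_eq_smul_irreduciblyCovariantChannel (r m : ℕ)
    (Φ : (BinaryForm r →ₗ[ℂ] BinaryForm r) →ₗ[ℂ]
      (BinaryForm m →ₗ[ℂ] BinaryForm m))
    (hCP : IsCompletelyPositive Φ)
    (hEq : IsEquivariant (rho r) (rho m) Φ) :
    ∃ c : ℝ, 0 ≤ c ∧
      ∃ Ψ : (BinaryForm r →ₗ[ℂ] BinaryForm r) →ₗ[ℂ]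
          (BinaryForm m →ₗ[ℂ] BinaryForm m),
        IsIrreduciblyCovariantChannel (rho r) (rho m) Ψ ∧
          Φ = (c : ℂ) • Ψ := by
  have hr := rho_isIrreducible r
  have hm := rho_isIrreducible m
  have hdim (n : ℕ) : 0 < Module.finrank ℂ (BinaryForm n) := by
    rw [Module.finrank_pos_iff_exists_ne_zero]
    refine ⟨BinaryForm.mono 0, fun h => ?_⟩
    have := BinaryForm.coef_mono (m := n) 0 0
    rw [h] at this
    simp [BinaryForm.coef] at this
  have hsmul (c : ℂ) (Ψ) (h : IsEquivariant (rho r)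
      (rho m) Ψ) : IsEquivariant (rho r)
      (rho m) (c • Ψ) :=
    ⟨fun g A => by rw [LinearMap.smul_apply, h.isIntertwining, LinearMap.smul_apply, map_smul]⟩
  obtain ⟨c, hc⟩ := exists_eq_mul_trace (rho r) hr
    (LinearMap.trace ℂ (BinaryForm m) ∘ₗ Φ) fun g A => by
      rw [LinearMap.comp_apply, hEq.isIntertwining, trace_linHom,
        LinearMap.comp_apply]
  have hc0 : 0 ≤ c := by
    have h1 := trace_nonneg_of_nonneg
      (hCP.nonneg (zero_le_one : (0 : BinaryForm r →L[ℂ] _) ≤ 1))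
    have h2 : LinearMap.trace ℂ (BinaryForm m) (Φ 1) =
        c * (Module.finrank ℂ (BinaryForm r) : ℂ) := by
      rw [← LinearMap.trace_one]; exact hc 1
    have h3 : 0 ≤ c * (Module.finrank ℂ (BinaryForm r) : ℂ) := h2 ▸ h1
    have h4 : (Module.finrank ℂ (BinaryForm r) : ℂ) ≠ 0 := by exact_mod_cast (hdim r).ne'
    have h5 : (0 : ℂ) ≤ (((Module.finrank ℂ (BinaryForm r) : ℝ)⁻¹ : ℝ) : ℂ) := by
      rw [Complex.zero_le_real]; positivity
    have h6 := mul_nonneg h3 h5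
    rwa [Complex.ofReal_inv, Complex.ofReal_natCast, mul_inv_cancel_right₀ h4] at h6
  -- In the order on `ℂ`, a number comparable with a real one is itself real.
  obtain ⟨c, rfl⟩ : ∃ d : ℝ, c = d := ⟨c.re, Complex.eq_re_of_ofReal_le hc0⟩
  have hc1 : 0 ≤ c := by exact_mod_cast hc0
  refine ⟨c, hc1, ?_⟩
  rcases hc1.eq_or_lt with rfl | hpos
  · have hm0 : (Module.finrank ℂ (BinaryForm m) : ℂ) ≠ 0 := by
      exact_mod_cast (hdim m).ne'
    -- Here `Φ = 0`. Dividing by the dimension of the target makes `A ↦ tr(A) 1` preserve the trace.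
    refine ⟨(((Module.finrank ℂ (BinaryForm m) : ℝ)⁻¹ : ℝ) : ℂ) •
      traceOne _ _, ⟨⟨?_, fun A => ?_⟩, ?_, hr, hm⟩, ?_⟩
    · exact isCompletelyPositive_traceOne.smul (by positivity)
    · rw [LinearMap.smul_apply, traceOne, LinearMap.smulRight_apply, map_smul,
        map_smul, LinearMap.trace_id, smul_eq_mul, smul_eq_mul]
      push_cast
      field_simp
    · exact hsmul _ _ (isEquivariant_traceOne _ _)
    · rw [Complex.ofReal_zero, zero_smul]
      exact hCP.eq_zero fun A => by simpa using hc A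
  · have hcne : (c : ℂ) ≠ 0 := by exact_mod_cast hpos.ne'
    refine ⟨((c⁻¹ : ℝ) : ℂ) • Φ, ⟨⟨?_, fun A => ?_⟩, ?_, hr, hm⟩, ?_⟩
    · exact hCP.smul (inv_nonneg.2 hc1)
    · rw [LinearMap.smul_apply, map_smul]
      have := hc A
      rw [LinearMap.comp_apply] at this
      rw [this, smul_eq_mul, Complex.ofReal_inv, inv_mul_cancel_left₀ hcne]
    · exact hsmul _ _ hEq
    · rw [smul_smul, Complex.ofReal_inv, mul_inv_cancel₀ hcne, one_smul]

end SU2Covariant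

theorem corollary4p2 (r m : ℕ)
    (Φ : (SU2Covariant.BinaryForm r →ₗ[ℂ] SU2Covariant.BinaryForm r) →ₗ[ℂ]
      (SU2Covariant.BinaryForm m →ₗ[ℂ] SU2Covariant.BinaryForm m))
    (hCP : SU2Covariant.IsCompletelyPositive Φ)
    (hEq : SU2Covariant.IsEquivariant (SU2Covariant.rho r) (SU2Covariant.rho m) Φ) :
    ∃ c : ℝ, 0 ≤ c ∧
      ∃ Ψ : (SU2Covariant.BinaryForm r →ₗ[ℂ] SU2Covariant.BinaryForm r) →ₗ[ℂ]
          (SU2Covariant.BinaryForm m →ₗ[ℂ] SU2Covariant.BinaryForm m),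
        SU2Covariant.IsIrreduciblyCovariantChannel (SU2Covariant.rho r) (SU2Covariant.rho m) Ψ ∧
          Φ = (c : ℂ) • Ψ :=
  SU2Covariant.exists_eq_smul_irreduciblyCovariantChannel r m Φ hCP hEq
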